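/- Let $G$ be a locally compact (Hausdorff) group with left Haar measure $\mu$, and let $\Gamma_1,\Gamma_2\le G$ be two finitely generated uniform lattices, i.e. finitely generated discrete subgroups with $G/\Gamma_i$ compact; write $\mu(G/\Gamma_i)$ for the covolume of $\Gamma_i$. Then there is a measure-scaling quasi-isometry $\Gamma_1\to\Gamma_2$ with scaling factor $\kappa=\mu(G/\Gamma_2)/\mu(G/\Gamma_1)$. In particular, if $\Gamma_1$ and $\Gamma_2$ are finitely generated finite-index subgroups of a group $\Gamma$, then there is a measure-scaling quasi-isometry $\Gamma_1\to\Gamma_2$ with scaling factor $\kappa=[\Gamma:\Gamma_2]/[\Gamma:\Gamma_1]$. Here a finitely generated group carries its counting measure and the left-invariant word distance of a finite generating set. For $\kappa>0$, a map $f:\Gamma_1\to\Gamma_2$ is a measure-scaling quasi-isometry of scaling factor $\kappa$ if, for any choice of finite generating sets, it is a quasi-isometry and there is a constant $C>0$ such that $$\big|\,\kappa\,|A|-|f^{-1}(A)|\,\big|\le C\,|\partial_2A|$$ for every $A\subset\Gamma_2$ that is a union of closed balls of radius $1$, where $\partial_2A$ is the set of points of $\Gamma_2$ that are at distance at most $2$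 both from a point of $A$ and from a point of $\Gamma_2\setminus A$. For infinite $A$ the inequality means $\kappa|A|\le |f^{-1}(A)|+C|\partial_2A|$ and $|f^{-1}(A)|\le\kappa|A|+C|\partial_2A|$ in $[0,\infty]$. -/

import Mathlib

open MeasureTheory
open scoped ENNReal

/-! ### Quasi-isometries and metric measure spaces

A metric measure space `(X, d, μ)` is given by an explicit distance function `d : X → X → ℝ` and a
measure `μ`, so that no (possibly competing) metric instance has to be put on the type `X`. -/

/-- `f` is a `(C, K)`-quasi-isometry from `(X, dX)` to `(Y, dY)` for some `C ≥ 1` and `K ≥ 0`. -/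
def IsQuasiIsometry {X Y : Type*} (dX : X → X → ℝ) (dY : Y → Y → ℝ) (f : X → Y) : Prop :=
  ∃ C K : ℝ, 1 ≤ C ∧ 0 ≤ K ∧
    (∀ x y : X, 1 / C * dX x y - K ≤ dY (f x) (f y) ∧ dY (f x) (f y) ≤ C * dX x y + K) ∧
    ∀ z : Y, ∃ x : X, dY z (f x) ≤ K

/-- A subset is thick if it is a union of closed balls of radius `1`. -/
def IsThick {Y : Type*} (d : Y → Y → ℝ) (A : Set Y) : Prop :=
  ∃ Z : Set Y, A = ⋃ z ∈ Z, {y : Y | d z y ≤ 1}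

/-- The (closed) `R`-neighbourhood `A^{+R}` of a subset `A`. -/
def nbhdOfRadius {Y : Type*} (d : Y → Y → ℝ) (R : ℝ) (A : Set Y) : Set Y :=
  {y : Y | ∃ a ∈ A, d y a ≤ R}

/-- The `R`-boundary `∂_R A = A^{+R} ∩ (Y \ A)^{+R}` of a subset `A`. -/
def boundaryOfRadius {Y : Type*} (d : Y → Y → ℝ) (R : ℝ) (A : Set Y) : Set Y :=
  nbhdOfRadius d R A ∩ nbhdOfRadius d R Aᶜ

/-- A measurable map `f : (X, μ) → (Y, dY, ν)` is quasi-`κ`-to-one, where `κ > 0`, if there is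
`C > 0` with `|κ ν(A) - μ(f⁻¹(A))| ≤ C ν(∂₂ A)` for every thick subset `A` of `Y`. The inequality
is written as two inequalities in `[0, ∞]`, so that it also makes sense, with its full content,
for sets of infinite measure. -/
def IsQuasiToOne {X Y : Type*} [MeasurableSpace X] [MeasurableSpace Y]
    (μ : Measure X) (dY : Y → Y → ℝ) (ν : Measure Y) (κ : ℝ) (f : X → Y) : Prop :=
  0 < κ ∧ Measurable f ∧ ∃ C : ℝ, 0 < C ∧ ∀ A : Set Y, IsThick dY A →
    ENNReal.ofReal κ * ν A ≤ μ (f ⁻¹' A) + ENNReal.ofReal C * ν (boundaryOfRadius dY 2 A) ∧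
    μ (f ⁻¹' A) ≤ ENNReal.ofReal κ * ν A + ENNReal.ofReal C * ν (boundaryOfRadius dY 2 A)

/-- `f : (X, dX, μ) → (Y, dY, ν)` is a measure-scaling quasi-isometry of scaling factor `κ`. -/
def IsMeasureScalingQI {X Y : Type*} [MeasurableSpace X] [MeasurableSpace Y]
    (dX : X → X → ℝ) (μ : Measure X) (dY : Y → Y → ℝ) (ν : Measure Y) (κ : ℝ) (f : X → Y) : Prop :=
  IsQuasiIsometry dX dY f ∧ IsQuasiToOne μ dY ν κ f

/-! ### Finitely generated groups as metric measure spaces -/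

/-- The word length of `g` with respect to `S`: the least length of a word in the elements of `S`
and their inverses with product `g`. (It is used only for generating sets `S`.) -/
noncomputable def wordLength {Γ : Type*} [Group Γ] (S : Set Γ) (g : Γ) : ℕ :=
  sInf {n : ℕ | ∃ l : List Γ, l.length = n ∧ (∀ s ∈ l, s ∈ S ∨ s⁻¹ ∈ S) ∧ l.prod = g}

/-- The left-invariant word distance `d_S(g, h) = |g⁻¹ h|_S`. -/
noncomputable def wordDist {Γ : Type*} [Group Γ] (S : Set Γ) (g h : Γ) : ℝ :=
  (wordLength S (g⁻¹ * h) : ℝ)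

/-- `f : Γ₁ → Γ₂` is a measure-scaling quasi-isometry of scaling factor `κ` between finitely
generated groups: all subsets are measurable, the measures are the counting measures, and the
distances are the word distances of arbitrary finite generating sets. -/
def IsGroupMeasureScalingQI {Γ₁ Γ₂ : Type*} [Group Γ₁] [Group Γ₂] (κ : ℝ) (f : Γ₁ → Γ₂) : Prop :=
  ∀ (S₁ : Set Γ₁) (S₂ : Set Γ₂),
    S₁.Finite → Subgroup.closure S₁ = ⊤ → S₂.Finite → Subgroup.closure S₂ = ⊤ →
      @IsMeasureScalingQI Γ₁ Γ₂ ⊤ ⊤ (wordDist S₁) (@Measure.count Γ₁ ⊤)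
        (wordDist S₂) (@Measure.count Γ₂ ⊤) κ f

/-! ### Uniform lattices -/

/-- A uniform lattice in a topological group: a discrete cocompact subgroup. -/
def IsUniformLattice {G : Type*} [Group G] [TopologicalSpace G] (Γ : Subgroup G) : Prop :=
  DiscreteTopology Γ ∧ CompactSpace (G ⧸ Γ)

/-- The covolume `μ(G/Γ)`: the `μ`-measure of a fundamental domain for the action of `Γ` on `G` by
right translations, whose orbit space is `G/Γ`. -/
noncomputable def latticeCovolume {G : Type*} [Group G] [MeasurableSpace G] (μ : Measure G)
    (Γ : Subgroup G) : ℝ≥0∞ :=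
  covolume Γ.op G μ

/-! Each lattice has a relatively compact Borel set `D i` meeting every coset `Γ i * g` exactly
once. The map `f` sends `x` to the unique `γ` with `x ∈ γ D₂`; the same recipe with `D₁` gives `g`
in the other direction. Both move points of `G` by relatively compact amounts. Since a compact set
contains finitely many lattice elements, `f` and `g` are Lipschitz for word metrics and mutually
inverse up to bounded error.

For scaling, compare volumes in `G`: the translates `A D₂` and `f⁻¹(A) D₁` have measures `|A| μ(D₂)`
and `|f⁻¹(A)| μ(D₁)`. They differ only inside translates `γ D₂` from which a step in a fixed finite
set crosses the border of `A`. Following a word for that step shows that the number of such `γ` is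
at most a constant times `|∂₂A|`. Dividing by `μ(D₁)` gives the factor `μ(D₂) / μ(D₁)`.

This is the ratio of covolumes because a lattice forces `G` to be unimodular. The finite-index case
is that of a discrete group. -/

/-! ### Word metrics -/

section WordMetric

variable {Γ : Type*} [Group Γ] {S : Set Γ}

theorem exists_word (hS : Subgroup.closure S = ⊤) (g : Γ) :
    ∃ l : List Γ, l.length = wordLength S g ∧ (∀ s ∈ l, s ∈ S ∨ s⁻¹ ∈ S) ∧ l.prod = g := by
  have hne : {n : ℕ | ∃ l : List Γ, l.length = n ∧ (∀ s ∈ l, s ∈ S ∨ s⁻¹ ∈ S) ∧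
      l.prod = g}.Nonempty := by
    obtain ⟨l, hl, hp⟩ := Submonoid.exists_list_of_mem_closure
      (show g ∈ Submonoid.closure (S ∪ S⁻¹) by
        rw [← Subgroup.closure_toSubmonoid, hS]
        trivial)
    exact ⟨_, l, rfl, hl, hp⟩
  exact Nat.sInf_mem hne

theorem wordLength_prod_le (l : List Γ) (hl : ∀ s ∈ l, s ∈ S ∨ s⁻¹ ∈ S) :
    wordLength S l.prod ≤ l.length :=
  Nat.sInf_le ⟨l, rfl, hl, rfl⟩

theorem wordLength_one : wordLength S (1 : Γ) = 0 :=
  Nat.le_zero.1 (wordLength_prod_le (S := S) [] (by simp))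

theorem wordLength_mul_le (hS : Subgroup.closure S = ⊤) (g h : Γ) :
    wordLength S (g * h) ≤ wordLength S g + wordLength S h := by
  obtain ⟨l, hl, hls, rfl⟩ := exists_word hS g
  obtain ⟨m, hm, hms, rfl⟩ := exists_word hS h
  rw [← hl, ← hm, ← List.prod_append, ← List.length_append]
  refine wordLength_prod_le _ fun s hs => ?_
  rcases List.mem_append.1 hs with h | h
  exacts [hls s h, hms s h]

theorem wordLength_inv_le (hS : Subgroup.closure S = ⊤) (g : Γ) :
    wordLength S g⁻¹ ≤ wordLength S g := by
  obtain ⟨l, hl, hls, rfl⟩ := exists_word hS g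
  rw [← hl, List.prod_inv_reverse]
  refine (wordLength_prod_le _ fun s hs => ?_).trans (by simp)
  simp only [List.mem_reverse, List.mem_map] at hs
  obtain ⟨t, ht, rfl⟩ := hs
  rw [inv_inv]
  exact (hls t ht).symm

theorem wordDist_comm (hS : Subgroup.closure S = ⊤) (g h : Γ) :
    wordDist S g h = wordDist S h g := by
  have key : ∀ g h : Γ, wordDist S g h ≤ wordDist S h g := fun g h => by
    have := wordLength_inv_le hS (h⁻¹ * g)
    rw [mul_inv_rev, inv_inv] at this
    exact Nat.cast_le.2 this
  exact le_antisymm (key g h) (key h g)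

theorem wordDist_triangle (hS : Subgroup.closure S = ⊤) (g h k : Γ) :
    wordDist S g k ≤ wordDist S g h + wordDist S h k := by
  have := wordLength_mul_le hS (g⁻¹ * h) (h⁻¹ * k)
  rw [mul_assoc, mul_inv_cancel_left] at this
  unfold wordDist
  exact_mod_cast this

theorem wordDist_self (g : Γ) : wordDist S g g = 0 := by
  simp [wordDist, wordLength_one]

theorem wordDist_mul_letter_le (g : Γ) {s : Γ} (hs : s ∈ S ∨ s⁻¹ ∈ S) :
    wordDist S g (g * s) ≤ 1 := by
  have := wordLength_prod_le (S := S) [s] (by simpa using hs)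
  rw [wordDist, inv_mul_cancel_left]
  simp only [List.prod_singleton, List.length_singleton] at this
  exact_mod_cast this

theorem finite_wordLength_le (hS : Subgroup.closure S = ⊤) (hfin : S.Finite) (n : ℕ) :
    {g : Γ | wordLength S g ≤ n}.Finite := by
  have hT : {s : Γ | s ∈ S ∨ s⁻¹ ∈ S}.Finite :=
    hfin.union (hfin.preimage inv_injective.injOn)
  have : Finite {s : Γ // s ∈ S ∨ s⁻¹ ∈ S} := hT
  refine ((List.finite_length_le {s : Γ // s ∈ S ∨ s⁻¹ ∈ S} n).image
    (fun l => (l.map Subtype.val).prod)).subset fun g hg => ?_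
  obtain ⟨l, hl, hls, rfl⟩ := exists_word hS g
  refine ⟨l.attach.map fun s => ⟨s.1, hls s.1 s.2⟩, ?_, ?_⟩
  · simpa [hl] using hg
  · simp [Function.comp_def]

theorem Set.Finite.exists_wordLength_le {T : Set Γ} (hT : T.Finite) :
    ∃ n : ℕ, ∀ t ∈ T, wordLength S t ≤ n := by
  obtain ⟨n, hn⟩ := (hT.image (wordLength S)).bddAbove
  exact ⟨n, fun t ht => hn ⟨t, ht, rfl⟩⟩

theorem countable_of_group_fg [Group.FG Γ] : Countable Γ := by
  obtain ⟨α, _, φ, hφ⟩ := Monoid.fg_iff_exists_freeGroup_hom_surjective_finite.1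
    (Group.fg_iff_monoid_fg.1 ‹Group.FG Γ›)
  have : Countable (FreeMonoid α) := inferInstanceAs (Countable (List α))
  exact hφ.countable

/-- The points from which one can leave or enter `A` by a step in `T`. -/
def stepBoundary (T A : Set Γ) : Set Γ :=
  {a | ∃ b, a⁻¹ * b ∈ T ∧ ¬(a ∈ A ↔ b ∈ A)}

/-- A path from one side of `A` to the other has a first letter at which membership changes; the
point just before it is within distance `1` of both sides. -/
theorem exists_mem_boundaryOfRadius (hS : Subgroup.closure S = ⊤) (A : Set Γ) (l : List Γ)
    (hl : ∀ s ∈ l, s ∈ S ∨ s⁻¹ ∈ S) (a : Γ) (ha : ¬(a ∈ A ↔ a * l.prod ∈ A)) :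
    ∃ p, wordLength S p ≤ l.length ∧ a * p ∈ boundaryOfRadius (wordDist S) 2 A := by
  induction l generalizing a with
  | nil => simp at ha
  | cons s l ih =>
    have hs := hl s (by simp)
    have hl' : ∀ s ∈ l, s ∈ S ∨ s⁻¹ ∈ S := fun t ht => hl t (by simp [ht])
    by_cases h : a ∈ A ↔ a * s ∈ A
    · obtain ⟨p, hp, hap⟩ := ih hl' (a * s) (by
        rwa [List.prod_cons, ← mul_assoc, h] at ha)
      refine ⟨s * p, ?_, by rwa [← mul_assoc]⟩
      have h1 := wordLength_mul_le hS s p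
      have h2 := wordLength_prod_le (S := S) [s] (by simpa using hs)
      simp only [List.prod_singleton, List.length_singleton] at h2
      rw [List.length_cons]
      omega
    · refine ⟨1, by simp [wordLength_one], ?_⟩
      rw [mul_one]
      have h0 : wordDist S a a ≤ 2 := by rw [wordDist_self]; norm_num
      have h1 : wordDist S a (a * s) ≤ 2 := (wordDist_mul_letter_le a hs).trans (by norm_num)
      by_cases haA : a ∈ A
      · exact ⟨⟨a, haA, h0⟩, ⟨a * s, fun h' => h ⟨fun _ => h', fun _ => haA⟩, h1⟩⟩
      · refine ⟨⟨a * s, ?_, h1⟩, ⟨a, haA, h0⟩⟩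
        by_contra h'
        exact h ⟨fun h => absurd h haA, fun h => absurd h h'⟩

theorem exists_count_stepBoundary_le (hS : Subgroup.closure S = ⊤) (hfin : S.Finite) {T : Set Γ}
    (hT : T.Finite) : ∃ C : ℕ, ∀ A : Set Γ, @Measure.count Γ ⊤ (stepBoundary T A) ≤
      C * @Measure.count Γ ⊤ (boundaryOfRadius (wordDist S) 2 A) := by
  obtain ⟨n, hn⟩ := hT.exists_wordLength_le (S := S)
  have hB := finite_wordLength_le hS hfin n
  refine ⟨hB.toFinset.card, fun A => ?_⟩
  let _ : MeasurableSpace Γ := ⊤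
  set B := boundaryOfRadius (wordDist S) 2 A
  -- Each such `a` is within a bounded right translation of `B`, and right translations preserve
  -- counting measure.
  have hsub : stepBoundary T A ⊆ ⋃ p ∈ hB.toFinset, (· * p) ⁻¹' B := by
    rintro a ⟨b, hab, hA⟩
    obtain ⟨l, hl, hls, hp⟩ := exists_word hS (a⁻¹ * b)
    obtain ⟨p, hpl, hap⟩ := exists_mem_boundaryOfRadius hS A l hls a (by
      rwa [hp, mul_inv_cancel_left])
    refine Set.mem_biUnion (x := p) ?_ hap
    simpa using hpl.trans (hl.trans_le (hn _ hab))
  calc Measure.count (stepBoundary T A)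
      ≤ Measure.count (⋃ p ∈ hB.toFinset, (· * p) ⁻¹' B) := measure_mono hsub
    _ ≤ ∑ p ∈ hB.toFinset, Measure.count ((· * p) ⁻¹' B) := measure_biUnion_finset_le _ _
    _ = ∑ p ∈ hB.toFinset, Measure.count B := by
        refine Finset.sum_congr rfl fun p _ => ?_
        rw [Measure.count_apply (MeasurableSpace.measurableSet_top), Measure.count_apply (MeasurableSpace.measurableSet_top),
          Set.encard_preimage_of_bijective (Group.mulRight_bijective p)]
    _ = _ := by rw [Finset.sum_const, nsmul_eq_mul]

end WordMetric

/-! ### Quasi-isometries from finiteness conditions -/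

section QuasiIsometry

variable {Γ₁ Γ₂ : Type*} [Group Γ₁] [Group Γ₂] {S₁ : Set Γ₁} {S₂ : Set Γ₂}

/-- A map between groups under which each right translation has finitely many increments. -/
def HasFiniteIncrements (f : Γ₁ → Γ₂) : Prop :=
  ∀ s, (Set.range fun x => (f x)⁻¹ * f (x * s)).Finite

theorem HasFiniteIncrements.exists_wordDist_le {f : Γ₁ → Γ₂} (hf : HasFiniteIncrements f)
    (hS₁ : Subgroup.closure S₁ = ⊤) (hfin : S₁.Finite) (hS₂ : Subgroup.closure S₂ = ⊤) :
    ∃ C : ℝ, 1 ≤ C ∧ ∀ x y, wordDist S₂ (f x) (f y) ≤ C * wordDist S₁ x y := by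
  have hT : {s : Γ₁ | s ∈ S₁ ∨ s⁻¹ ∈ S₁}.Finite :=
    hfin.union (hfin.preimage inv_injective.injOn)
  obtain ⟨n, hn⟩ := (hT.biUnion fun s _ => hf s).exists_wordLength_le (S := S₂)
  have key : ∀ l : List Γ₁, (∀ s ∈ l, s ∈ S₁ ∨ s⁻¹ ∈ S₁) → ∀ x,
      wordDist S₂ (f x) (f (x * l.prod)) ≤ (n + 1) * l.length := by
    intro l
    induction l with
    | nil => intro _ x; simp [wordDist_self]
    | cons s l ih =>
      intro hl x
      have h1 := ih (fun t ht => hl t (by simp [ht])) (x * s)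
      have h2 : wordDist S₂ (f x) (f (x * s)) ≤ n :=
        Nat.cast_le.2 (hn _ (Set.mem_biUnion (hl s (by simp)) ⟨x, rfl⟩))
      have h3 := wordDist_triangle hS₂ (f x) (f (x * s)) (f (x * s * l.prod))
      rw [List.prod_cons, List.length_cons, ← mul_assoc]
      push_cast
      linarith
  refine ⟨n + 1, by linarith [(Nat.cast_nonneg n : (0 : ℝ) ≤ n)], fun x y => ?_⟩
  obtain ⟨l, hl, hls, hp⟩ := exists_word hS₁ (x⁻¹ * y)
  have := key l hls x
  rwa [hp, mul_inv_cancel_left, hl] at this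

theorem isQuasiIsometry_of_finite {f : Γ₁ → Γ₂} {g : Γ₂ → Γ₁} (hf : HasFiniteIncrements f)
    (hg : HasFiniteIncrements g) (hgf : (Set.range fun x => x⁻¹ * g (f x)).Finite)
    (hfg : (Set.range fun z => z⁻¹ * f (g z)).Finite)
    (hS₁ : Subgroup.closure S₁ = ⊤) (hfin₁ : S₁.Finite) (hS₂ : Subgroup.closure S₂ = ⊤)
    (hfin₂ : S₂.Finite) : IsQuasiIsometry (wordDist S₁) (wordDist S₂) f := by
  obtain ⟨C, hC1, hC⟩ := hf.exists_wordDist_le hS₁ hfin₁ hS₂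
  obtain ⟨C', hC'1, hC'⟩ := hg.exists_wordDist_le hS₂ hfin₂ hS₁
  obtain ⟨n, hn⟩ := hgf.exists_wordLength_le (S := S₁)
  obtain ⟨m, hm⟩ := hfg.exists_wordLength_le (S := S₂)
  have hn0 : (0 : ℝ) ≤ n := n.cast_nonneg
  have hm0 : (0 : ℝ) ≤ m := m.cast_nonneg
  have hd : ∀ x y, 0 ≤ wordDist S₁ x y := fun x y => Nat.cast_nonneg _
  have hd' : ∀ x y, 0 ≤ wordDist S₂ x y := fun x y => Nat.cast_nonneg _
  -- The lower bound comes from the Lipschitz bound for `g`, after moving `x` and `y` to their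
  -- images under `g ∘ f` at cost `n` each; `m` serves coarse surjectivity.
  refine ⟨max C C', 2 * n + m, le_max_of_le_left hC1, by positivity, fun x y => ⟨?_, ?_⟩,
    fun z => ⟨g z, ?_⟩⟩
  · have hpos : 0 < max C C' := lt_of_lt_of_le one_pos (le_max_of_le_left hC1)
    have h1 : wordDist S₁ x (g (f x)) ≤ n := Nat.cast_le.2 (hn _ ⟨x, rfl⟩)
    have h2 : wordDist S₁ y (g (f y)) ≤ n := Nat.cast_le.2 (hn _ ⟨y, rfl⟩)
    rw [wordDist_comm hS₁] at h2
    have h3 := wordDist_triangle hS₁ x (g (f x)) y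
    have h4 := wordDist_triangle hS₁ (g (f x)) (g (f y)) y
    have h5 := hC' (f x) (f y)
    have h6 : C' * wordDist S₂ (f x) (f y) ≤ max C C' * wordDist S₂ (f x) (f y) :=
      mul_le_mul_of_nonneg_right (le_max_right _ _) (hd' _ _)
    have h7 : (1 : ℝ) ≤ max C C' := le_max_of_le_left hC1
    rw [sub_le_iff_le_add, one_div, inv_mul_le_iff₀ hpos]
    nlinarith
  · have : C * wordDist S₁ x y ≤ max C C' * wordDist S₁ x y :=
      mul_le_mul_of_nonneg_right (le_max_left _ _) (hd _ _)
    linarith [hC x y]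
  · have : wordDist S₂ z (f (g z)) ≤ m := Nat.cast_le.2 (hm _ ⟨z, rfl⟩)
    linarith

end QuasiIsometry

/-! ### Strict fundamental domains of lattices -/

section FundamentalDomain

open scoped Pointwise
open Topology

variable {G : Type*} [Group G]

/-- `D` is a strict fundamental domain for the left translation action of `Γ`. -/
def IsStrictDomain (Γ : Subgroup G) (D : Set G) : Prop :=
  ∀ g : G, ∃! γ : Γ, (γ : G)⁻¹ * g ∈ D

theorem IsStrictDomain.eq {Γ : Subgroup G} {D : Set G} (hD : IsStrictDomain Γ D) {g : G}
    {γ γ' : Γ} (h : (γ : G)⁻¹ * g ∈ D) (h' : (γ' : G)⁻¹ * g ∈ D) : γ = γ' :=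
  (hD g).unique h h'

theorem IsStrictDomain.isFundamentalDomain [MeasurableSpace G] {Γ : Subgroup G} {D : Set G}
    (hD : IsStrictDomain Γ D) (hm : MeasurableSet D) (μ : Measure G) :
    IsFundamentalDomain Γ D μ := by
  refine IsFundamentalDomain.mk' hm.nullMeasurableSet fun g => ?_
  obtain ⟨γ, hγ, huniq⟩ := hD g
  refine ⟨γ⁻¹, by simpa [Subgroup.smul_def] using hγ, fun δ hδ => ?_⟩
  rw [← huniq δ⁻¹ (by simpa [Subgroup.smul_def] using hδ), inv_inv]

/-- Inversion exchanges left and right translations; the covolume is defined through the right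
action. -/
theorem IsStrictDomain.isFundamentalDomain_op [MeasurableSpace G] {Γ : Subgroup G} {D : Set G}
    (hD : IsStrictDomain Γ D) (hm : MeasurableSet D⁻¹) (μ : Measure G) :
    IsFundamentalDomain Γ.op D⁻¹ μ := by
  refine IsFundamentalDomain.mk' hm.nullMeasurableSet fun g => ?_
  obtain ⟨γ, hγ, huniq⟩ := hD g⁻¹
  refine ⟨⟨MulOpposite.op (γ : G), γ.2⟩, by simpa [Subgroup.smul_def] using hγ, fun δ hδ => ?_⟩
  have := huniq ⟨δ.1.unop, δ.2⟩ (by simpa [Subgroup.smul_def] using hδ)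
  rw [← this]
  rfl

theorem IsStrictDomain.preimage_mul_right {Γ : Subgroup G} {D : Set G}
    (hD : IsStrictDomain Γ D) (g : G) : IsStrictDomain Γ ((· * g) ⁻¹' D) := fun x => by
  simpa [mul_assoc] using hD (x * g)

/-- The union of the translates of `D` by elements of `A`. -/
def translates {Γ : Subgroup G} (A : Set Γ) (D : Set G) : Set G :=
  {g | ∃ γ ∈ A, (γ : G)⁻¹ * g ∈ D}

theorem IsStrictDomain.measure_translates [MeasurableSpace G] [MeasurableMul G] {Γ : Subgroup G}
    [Countable Γ] {D : Set G} (hD : IsStrictDomain Γ D) (hm : MeasurableSet D) (μ : Measure G)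
    [μ.IsMulLeftInvariant] (A : Set Γ) :
    μ (translates A D) = @Measure.count Γ ⊤ A * μ D := by
  have h : translates A D = ⋃ γ ∈ A, ((γ : G)⁻¹ * ·) ⁻¹' D := by
    ext g
    simp [translates]
  rw [h, measure_biUnion A.to_countable]
  · simp only [measure_preimage_mul]
    rw [@Measure.count_apply _ ⊤ _ (MeasurableSpace.measurableSet_top), ENNReal.tsum_const]
    rfl
  · intro γ _ γ' _ hne
    exact Set.disjoint_left.2 fun g h h' => hne (hD.eq h h')
  · exact fun γ _ => measurable_const_mul _ hm

variable [TopologicalSpace G] [IsTopologicalGroup G]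

theorem finite_coe_mem_of_isCompact [T2Space G] (Γ : Subgroup G) [DiscreteTopology Γ] {K : Set G}
    (hK : IsCompact K) : {γ : Γ | (γ : G) ∈ K}.Finite := by
  have := Γ.tendsto_coe_cofinite_of_discrete (isDiscrete_iff_discreteTopology.2 ‹_›)
    hK.compl_mem_cocompact
  simp only [Filter.mem_map, Filter.mem_cofinite, Set.preimage_compl, compl_compl] at this
  exact this

/-- A uniform lattice has a relatively compact Borel strict fundamental domain. -/
theorem IsUniformLattice.exists_isStrictDomain [LocallyCompactSpace G] [MeasurableSpace G]
    [BorelSpace G] {Γ : Subgroup G} (hΓ : IsUniformLattice Γ) :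
    ∃ D : Set G, IsStrictDomain Γ D ∧ MeasurableSet D ∧ ∃ K, IsCompact K ∧ D ⊆ K := by
  obtain ⟨_, _⟩ := hΓ
  obtain ⟨W, hW, hWΓ⟩ := nhds_inter_eq_singleton_of_mem_discrete
    (isDiscrete_iff_discreteTopology.2 ‹DiscreteTopology Γ›) Γ.one_mem
  obtain ⟨V, hVo, hV1, hVW⟩ : ∃ V : Set G, IsOpen V ∧ (1 : G) ∈ V ∧
      ∀ x ∈ V, ∀ y ∈ V, x⁻¹ * y ∈ W := by
    have hc : Filter.Tendsto (fun p : G × G => p.1⁻¹ * p.2) (𝓝 (1, 1)) (𝓝 1) := by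
      have : Continuous fun p : G × G => p.1⁻¹ * p.2 := by fun_prop
      simpa using this.tendsto (1, 1)
    have := hc hW
    rw [nhds_prod_eq] at this
    obtain ⟨V, hV, hVV⟩ := Filter.mem_prod_same_iff.1 this
    obtain ⟨V', hV'V, hV'o, hV'1⟩ := mem_nhds_iff.1 hV
    exact ⟨V', hV'o, hV'1, fun x hx y hy => hVV (Set.mk_mem_prod (hV'V hx) (hV'V hy))⟩
  obtain ⟨K, hK, hK1⟩ := exists_compact_mem_nhds (1 : G)
  set U := V ∩ interior K with hU
  have hUo : IsOpen U := hVo.inter isOpen_interior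
  have hU1 : (1 : G) ∈ U := ⟨hV1, mem_interior_iff_mem_nhds.2 hK1⟩
  -- Thus `U` injects into `G ⧸ Γ`.
  have hinj : ∀ x ∈ U, ∀ y ∈ U, x⁻¹ * y ∈ Γ → x = y := fun x hx y hy hxy => by
    have : x⁻¹ * y ∈ W ∩ (Γ : Set G) := ⟨hVW x hx.1 y hy.1, hxy⟩
    rw [hWΓ] at this
    exact inv_mul_eq_one.1 this
  have hUΓ : ∀ g : G, IsOpen {x : G | ∃ γ ∈ Γ, g⁻¹ * (x * γ) ∈ U} := fun g => by
    have : {x : G | ∃ γ ∈ Γ, g⁻¹ * (x * γ) ∈ U} = ⋃ γ ∈ Γ, (fun x => g⁻¹ * (x * γ)) ⁻¹' U := by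
      ext
      simp
    rw [this]
    exact isOpen_biUnion fun γ _ => hUo.preimage (by fun_prop)
  -- A Borel transversal for the cosets `xΓ` meeting finitely many translates `gU` is built
  -- greedily: from each new `gU`, discard the open saturated set `R` of cosets already represented.
  have key : ∀ t : Finset G, ∃ F : Set G, MeasurableSet F ∧ F ⊆ ⋃ g ∈ t, (g⁻¹ * ·) ⁻¹' U ∧
      (∀ x ∈ F, ∀ y ∈ F, x⁻¹ * y ∈ Γ → x = y) ∧
      ∀ g ∈ t, ∀ x, (∃ γ ∈ Γ, g⁻¹ * (x * γ) ∈ U) → ∃ γ ∈ Γ, x * γ ∈ F := by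
    classical
    intro t
    induction t using Finset.induction with
    | empty => exact ⟨∅, by simp⟩
    | insert g t _ ih =>
      obtain ⟨F, hFm, hFs, hFi, hFc⟩ := ih
      set R := ⋃ h ∈ t, {x : G | ∃ γ ∈ Γ, h⁻¹ * (x * γ) ∈ U} with hR
      have hRo : IsOpen R := isOpen_biUnion fun h _ => hUΓ h
      have hRΓ : ∀ x γ, γ ∈ Γ → x * γ ∈ R → x ∈ R := fun x γ hγ hx => by
        simp only [hR, Set.mem_iUnion, Set.mem_ofPred_eq] at hx ⊢
        obtain ⟨h, hh, δ, hδ, hx⟩ := hx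
        exact ⟨h, hh, γ * δ, Γ.mul_mem hγ hδ, by simpa [mul_assoc] using hx⟩
      have hFR : F ⊆ R := fun x hx => by
        obtain ⟨h, hh, hxh⟩ := Set.mem_iUnion₂.1 (hFs hx)
        exact Set.mem_biUnion hh ⟨1, Γ.one_mem, by simpa using hxh⟩
      refine ⟨F ∪ ((g⁻¹ * ·) ⁻¹' U \ R), hFm.union ((hUo.preimage
        (continuous_const_mul _)).measurableSet.diff hRo.measurableSet), ?_, ?_, ?_⟩
      · rw [Finset.set_biUnion_insert, Set.union_comm]
        exact Set.union_subset_union Set.sdiff_subset hFs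
      · rintro x (hx | hx) y (hy | hy) hxy
        · exact hFi x hx y hy hxy
        · refine absurd (hRΓ y (y⁻¹ * x) ?_ (by simpa using hFR hx)) hy.2
          simpa using Γ.inv_mem hxy
        · exact absurd (hRΓ x _ hxy (by simpa using hFR hy)) hx.2
        · have := hinj _ hx.1 _ hy.1 (by simpa [mul_assoc] using hxy)
          exact mul_left_cancel this
      · intro h hh x hx
        by_cases hxR : x ∈ R
        · simp only [hR, Set.mem_iUnion] at hxR
          obtain ⟨h', hh', hx'⟩ := hxR
          obtain ⟨γ, hγ, hxγ⟩ := hFc h' hh' x hx'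
          exact ⟨γ, hγ, Or.inl hxγ⟩
        · rcases Finset.mem_insert.1 hh with rfl | hh
          · obtain ⟨γ, hγ, hxγ⟩ := hx
            exact ⟨γ, hγ, Or.inr ⟨hxγ, fun h => hxR (hRΓ x γ hγ h)⟩⟩
          · exact absurd (Set.mem_biUnion hh hx) hxR
  obtain ⟨t, ht⟩ := isCompact_univ.elim_finite_subcover
    (fun g : G => ((↑) : G → G ⧸ Γ) '' ((g⁻¹ * ·) ⁻¹' U))
    (fun g => QuotientGroup.isOpenMap_coe _ (hUo.preimage (continuous_const_mul _)))
    (fun q _ => by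
      obtain ⟨g, rfl⟩ := QuotientGroup.mk_surjective q
      exact Set.mem_iUnion.2 ⟨g, g, by simpa using hU1, rfl⟩)
  obtain ⟨F, hFm, hFs, hFi, hFc⟩ := key t
  -- `F` represents the cosets `xΓ`, so its inverse represents the cosets `Γx`.
  refine ⟨F⁻¹, fun g => ?_, hFm.inv, (⋃ g ∈ t, (g * ·) '' K)⁻¹, ?_, ?_⟩
  · obtain ⟨h, hh, y, hy, hyg⟩ : ∃ h ∈ t, ∃ y, h⁻¹ * y ∈ U ∧ (y : G ⧸ Γ) = (g⁻¹ : G) := by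
      simpa using ht (Set.mem_univ ((g⁻¹ : G) : G ⧸ Γ))
    obtain ⟨γ, hγ, hgγ⟩ := hFc h hh g⁻¹
      ⟨g * y, by simpa using Γ.inv_mem (QuotientGroup.eq.1 hyg), by simpa using hy⟩
    refine ⟨⟨γ, hγ⟩, by simpa using hgγ, fun δ hδ => ?_⟩
    have := hFi _ (show g⁻¹ * (δ : G) ∈ F by simpa using hδ) _ hgγ
      (by simpa [mul_assoc] using Γ.mul_mem (Γ.inv_mem δ.2) hγ)
    exact Subtype.ext (mul_left_cancel this)
  · exact (t.isCompact_biUnion fun g _ => hK.image (continuous_const_mul g)).inv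
  · refine Set.inv_subset_inv.2 (hFs.trans (Set.iUnion₂_mono fun g _ x hx => ?_))
    exact ⟨g⁻¹ * x, interior_subset hx.2, by simp⟩

/-! ### Unimodularity and covolume -/

variable [MeasurableSpace G] [BorelSpace G]

/-- Otherwise countably many null translates would cover `G`. -/
theorem IsStrictDomain.measure_pos {Γ : Subgroup G} [Countable Γ] {D : Set G}
    (hD : IsStrictDomain Γ D) (hm : MeasurableSet D) (μ : Measure G) [μ.IsHaarMeasure] :
    0 < μ D := by
  rw [pos_iff_ne_zero]
  intro h
  have := hD.measure_translates hm μ Set.univ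
  rw [h, mul_zero, show translates (Set.univ : Set Γ) D = Set.univ from
    Set.eq_univ_of_forall fun g => by simpa [translates] using (hD g).exists] at this
  exact (isOpen_univ.measure_pos μ Set.univ_nonempty).ne' this

variable [LocallyCompactSpace G]

/-- A group with a strict fundamental domain of finite measure for a countable subgroup is
unimodular. -/
theorem IsStrictDomain.isMulRightInvariant {Γ : Subgroup G} [Countable Γ] {D : Set G}
    (hD : IsStrictDomain Γ D) (hm : MeasurableSet D) (μ : Measure G) [μ.IsHaarMeasure]
    [μ.Regular] (hfin : μ D ≠ ∞) : μ.IsMulRightInvariant := by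
  refine ⟨fun g => ?_⟩
  have : (μ.map (· * g)).Regular := Measure.Regular.map (Homeomorph.mulRight g)
  have hc := Measure.isMulLeftInvariant_eq_smul_of_regular (μ.map (· * g)) μ
  -- Right translation commutes with the left action, so it takes `D` to another fundamental domain,
  -- of equal measure. This forces the scalar to be `1`.
  have h1 : μ.map (· * g) D = μ D := by
    rw [Measure.map_apply (measurable_mul_const g) hm]
    exact ((hD.preimage_mul_right g).isFundamentalDomain (measurable_mul_const g hm) μ).measure_eq
      (hD.isFundamentalDomain hm μ)
  generalize Measure.haarScalarFactor (μ.map (· * g)) μ = c at hc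
  rw [hc, Measure.smul_apply, ENNReal.smul_def, smul_eq_mul] at h1
  have hc1 : (c : ℝ≥0∞) = 1 :=
    (ENNReal.mul_eq_right (hD.measure_pos hm μ).ne' hfin).1 h1
  rw [hc, ENNReal.coe_eq_one.1 hc1, one_smul]

theorem measure_inv_eq_of_isMulRightInvariant (μ : Measure G) [μ.IsHaarMeasure] [μ.Regular]
    [μ.IsMulRightInvariant] {D : Set G} (hpos : μ D ≠ 0) (hfin : μ D ≠ ∞) : μ D⁻¹ = μ D := by
  have hc := Measure.isMulLeftInvariant_eq_smul_of_regular μ.inv μ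
  generalize Measure.haarScalarFactor μ.inv μ = c at hc
  have h : ∀ s, μ s⁻¹ = c * μ s := fun s => by
    rw [← Measure.inv_apply, hc, Measure.smul_apply, ENNReal.smul_def, smul_eq_mul]
  -- Inverting twice gives `c² = 1`.
  have h2 : c * c * μ D = μ D := by
    rw [mul_assoc, ← h, ← h, inv_inv]
  have hcc : (c * c : ℝ≥0∞) = 1 := (ENNReal.mul_eq_right hpos hfin).1 h2
  have hcc' : c * c = 1 := by exact_mod_cast hcc
  have hc1 : c = 1 := (pow_eq_one_iff_of_nonneg zero_le two_ne_zero).1 (by rwa [sq])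
  rw [h, hc1, ENNReal.coe_one, one_mul]

theorem IsStrictDomain.latticeCovolume_eq {Γ : Subgroup G} [Countable Γ] {D : Set G}
    (hD : IsStrictDomain Γ D) (hm : MeasurableSet D) (μ : Measure G) [μ.IsHaarMeasure]
    [μ.Regular] (hfin : μ D ≠ ∞) : latticeCovolume μ Γ = μ D := by
  have := hD.isMulRightInvariant hm μ hfin
  have : Countable Γ.op := Γ.equivOp.symm.countable_iff.2 ‹_›
  have hF := hD.isFundamentalDomain_op hm.inv μ
  rw [latticeCovolume, hF.covolume_eq_volume,
    measure_inv_eq_of_isMulRightInvariant μ (hD.measure_pos hm μ).ne' hfin]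

end FundamentalDomain

/-! ### The comparison map between two lattices -/

section Lattices

open scoped Pointwise

variable {G : Type*} [Group G]

/-- Writing `p = γ d₂ = x d₁` and `x = f x * d₂'` gives `γ⁻¹ * f x = d₂ * d₁⁻¹ * d₂'⁻¹`. -/
theorem stepBoundary_of_mem {Γ₁ Γ₂ : Subgroup G} {D₁ D₂ K₁ K₂ : Set G} {f : Γ₁ → Γ₂}
    (hf : ∀ x, (f x : G)⁻¹ * x ∈ D₂) (hK₁ : D₁ ⊆ K₁) (hK₂ : D₂ ⊆ K₂) {A : Set Γ₂} {p : G}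
    {x : Γ₁} (hx : (x : G)⁻¹ * p ∈ D₁) {γ : Γ₂} (hγ : (γ : G)⁻¹ * p ∈ D₂)
    (hA : ¬(γ ∈ A ↔ f x ∈ A)) :
    γ ∈ stepBoundary {γ : Γ₂ | (γ : G) ∈ K₂ * K₁⁻¹ * K₂⁻¹} A := by
  refine ⟨f x, ?_, hA⟩
  have : ((γ⁻¹ * f x : Γ₂) : G) =
      ((γ : G)⁻¹ * p) * ((x : G)⁻¹ * p)⁻¹ * ((f x : G)⁻¹ * x)⁻¹ := by
    push_cast
    group
  rw [Set.mem_ofPred_eq, this]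
  exact Set.mul_mem_mul (Set.mul_mem_mul (hK₂ hγ) (Set.inv_mem_inv.2 (hK₁ hx)))
    (Set.inv_mem_inv.2 (hK₂ (hf x)))

variable [TopologicalSpace G] [IsTopologicalGroup G] [T2Space G]

theorem hasFiniteIncrements_of_mem {Γ₁ Γ₂ : Subgroup G} [DiscreteTopology Γ₂] {K : Set G}
    (hK : IsCompact K) {f : Γ₁ → Γ₂} (hf : ∀ x, (f x : G)⁻¹ * x ∈ K) :
    HasFiniteIncrements f := fun s => by
  refine (finite_coe_mem_of_isCompact Γ₂ ((hK.mul (isCompact_singleton (x := (s : G)))).mul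
    hK.inv)).subset ?_
  rintro _ ⟨x, rfl⟩
  have : (((f x)⁻¹ * f (x * s) : Γ₂) : G) =
      ((f x : G)⁻¹ * x) * s * ((f (x * s) : G)⁻¹ * (x * s : Γ₁))⁻¹ := by
    push_cast
    group
  rw [Set.mem_ofPred_eq, this]
  exact Set.mul_mem_mul (Set.mul_mem_mul (hf x) rfl) (Set.inv_mem_inv.2 (hf _))

theorem finite_range_inv_mul_comp {Γ₁ Γ₂ : Subgroup G} [DiscreteTopology Γ₁] {K₁ K₂ : Set G}
    (hK₁ : IsCompact K₁) (hK₂ : IsCompact K₂) {f : Γ₁ → Γ₂} {g : Γ₂ → Γ₁}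
    (hf : ∀ x, (f x : G)⁻¹ * x ∈ K₂) (hg : ∀ z, (g z : G)⁻¹ * z ∈ K₁) :
    (Set.range fun x => x⁻¹ * g (f x)).Finite := by
  refine (finite_coe_mem_of_isCompact Γ₁ (hK₂.inv.mul hK₁.inv)).subset ?_
  rintro _ ⟨x, rfl⟩
  have : ((x⁻¹ * g (f x) : Γ₁) : G) =
      ((f x : G)⁻¹ * x)⁻¹ * ((g (f x) : G)⁻¹ * f x)⁻¹ := by
    push_cast
    group
  rw [Set.mem_ofPred_eq, this]
  exact Set.mul_mem_mul (Set.inv_mem_inv.2 (hf x)) (Set.inv_mem_inv.2 (hg _))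

theorem isQuasiToOne_of_isStrictDomain [MeasurableSpace G] [BorelSpace G] {Γ₁ Γ₂ : Subgroup G}
    [Countable Γ₁] [Countable Γ₂] [DiscreteTopology Γ₂] {D₁ D₂ K₁ K₂ : Set G}
    (hD₁ : IsStrictDomain Γ₁ D₁) (hm₁ : MeasurableSet D₁) (hD₂ : IsStrictDomain Γ₂ D₂)
    (hm₂ : MeasurableSet D₂) (hK₁ : IsCompact K₁) (hK₂ : IsCompact K₂) (hDK₁ : D₁ ⊆ K₁)
    (hDK₂ : D₂ ⊆ K₂) (μ : Measure G) [μ.IsHaarMeasure] {f : Γ₁ → Γ₂}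
    (hf : ∀ x, (f x : G)⁻¹ * x ∈ D₂) {S : Set Γ₂} (hS : Subgroup.closure S = ⊤)
    (hfin : S.Finite) :
    @IsQuasiToOne Γ₁ Γ₂ ⊤ ⊤ (@Measure.count Γ₁ ⊤) (wordDist S) (@Measure.count Γ₂ ⊤)
      (μ D₂ / μ D₁).toReal f := by
  have h₁ : μ D₁ ≠ ∞ := ((measure_mono hDK₁).trans_lt hK₁.measure_lt_top).ne
  have h₂ : μ D₂ ≠ ∞ := ((measure_mono hDK₂).trans_lt hK₂.measure_lt_top).ne
  have p₁ : μ D₁ ≠ 0 := (hD₁.measure_pos hm₁ μ).ne'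
  have p₂ : μ D₂ ≠ 0 := (hD₂.measure_pos hm₂ μ).ne'
  have hκ : μ D₂ / μ D₁ ≠ ∞ := ENNReal.div_ne_top h₂ p₁
  have hT := finite_coe_mem_of_isCompact Γ₂ ((hK₂.mul hK₁.inv).mul hK₂.inv)
  set T := {γ : Γ₂ | (γ : G) ∈ K₂ * K₁⁻¹ * K₂⁻¹} with hTdef
  obtain ⟨n, hn⟩ := exists_count_stepBoundary_le hS hfin hT
  have hκpos : 0 < (μ D₂ / μ D₁).toReal := ENNReal.toReal_pos (ENNReal.div_ne_zero.2 ⟨p₂, h₁⟩) hκ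
  -- The summand `1` keeps the constant positive even if `n = 0`.
  refine ⟨hκpos, @measurable_from_top _ _ ⊤ f, n * (μ D₂ / μ D₁).toReal + 1, by positivity, fun A _ => ?_⟩
  have hC : (n : ℝ≥0∞) * (μ D₂ / μ D₁) ≤
      ENNReal.ofReal (n * (μ D₂ / μ D₁).toReal + 1) := by
    refine le_trans ?_ (ENNReal.ofReal_le_ofReal (le_add_of_nonneg_right zero_le_one))
    rw [ENNReal.ofReal_mul n.cast_nonneg, ENNReal.ofReal_natCast, ENNReal.ofReal_toReal hκ]
  have hcount₂ := fun B : Set Γ₂ => hD₂.measure_translates hm₂ μ B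
  have hcount₁ := hD₁.measure_translates hm₁ μ (f ⁻¹' A)
  have hb : @Measure.count Γ₂ ⊤ (stepBoundary T A) * (μ D₂ / μ D₁) ≤
      ENNReal.ofReal (n * (μ D₂ / μ D₁).toReal + 1) *
        @Measure.count Γ₂ ⊤ (boundaryOfRadius (wordDist S) 2 A) :=
    calc _ ≤ n * @Measure.count Γ₂ ⊤ (boundaryOfRadius (wordDist S) 2 A) * (μ D₂ / μ D₁) :=
          mul_le_mul_left (hn A) _
      _ = n * (μ D₂ / μ D₁) * @Measure.count Γ₂ ⊤ (boundaryOfRadius (wordDist S) 2 A) := by ring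
      _ ≤ _ := mul_le_mul_left hC _
  have hdiv : ∀ a : ℝ≥0∞, a * μ D₁ / μ D₁ = a := fun a => ENNReal.mul_div_cancel_right p₁ h₁
  -- Each `p` lies in one `γ D₂` and one `x D₁`; the two unions disagree at `p` only if `A`
  -- separates `γ` from `f x`.
  have s₁ : translates A D₂ ⊆ translates (f ⁻¹' A) D₁ ∪ translates (stepBoundary T A) D₂ := by
    rintro p ⟨γ, hγA, hγ⟩
    obtain ⟨x, hx⟩ := (hD₁ p).exists
    by_cases hxA : f x ∈ A
    · exact Or.inl ⟨x, hxA, hx⟩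
    · exact Or.inr ⟨γ, stepBoundary_of_mem hf hDK₁ hDK₂ hx hγ (by tauto), hγ⟩
  have s₂ : translates (f ⁻¹' A) D₁ ⊆ translates A D₂ ∪ translates (stepBoundary T A) D₂ := by
    rintro p ⟨x, hxA, hx⟩
    obtain ⟨γ, hγ⟩ := (hD₂ p).exists
    by_cases hγA : γ ∈ A
    · exact Or.inl ⟨γ, hγA, hγ⟩
    · exact Or.inr ⟨γ, stepBoundary_of_mem hf hDK₁ hDK₂ hx hγ (by
        rw [Set.mem_preimage] at hxA
        tauto), hγ⟩
  have i₁ := (measure_mono s₁).trans (measure_union_le (μ := μ) _ _)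
  have i₂ := (measure_mono s₂).trans (measure_union_le (μ := μ) _ _)
  rw [hcount₂, hcount₂, hcount₁] at i₁ i₂
  replace i₁ := ENNReal.div_le_div_right i₁ (μ D₁)
  replace i₂ := ENNReal.div_le_div_right i₂ (μ D₁)
  rw [ENNReal.add_div, hdiv, mul_div_assoc, mul_div_assoc] at i₁ i₂
  rw [ENNReal.ofReal_toReal hκ, mul_comm (μ D₂ / μ D₁)]
  exact ⟨i₁.trans (add_le_add_right hb _), i₂.trans (add_le_add_right hb _)⟩

theorem exists_isGroupMeasureScalingQI_of_isUniformLattice [LocallyCompactSpace G]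
    [MeasurableSpace G] [BorelSpace G] (μ : Measure G) [μ.IsHaarMeasure] [μ.Regular]
    {Γ₁ Γ₂ : Subgroup G} (h₁ : IsUniformLattice Γ₁) (h₂ : IsUniformLattice Γ₂)
    (fg₁ : Group.FG Γ₁) (fg₂ : Group.FG Γ₂) :
    ∃ f : Γ₁ → Γ₂, IsGroupMeasureScalingQI
      (latticeCovolume μ Γ₂ / latticeCovolume μ Γ₁).toReal f := by
  obtain ⟨D₁, hD₁, hm₁, K₁, hK₁, hDK₁⟩ := h₁.exists_isStrictDomain
  obtain ⟨D₂, hD₂, hm₂, K₂, hK₂, hDK₂⟩ := h₂.exists_isStrictDomain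
  have := h₁.1
  have := h₂.1
  have : Countable Γ₁ := countable_of_group_fg
  have : Countable Γ₂ := countable_of_group_fg
  choose f hf using fun x : Γ₁ => (hD₂ x).exists
  choose g hg using fun x : Γ₂ => (hD₁ x).exists
  have hf' := fun x => hDK₂ (hf x)
  have hg' := fun x => hDK₁ (hg x)
  rw [hD₁.latticeCovolume_eq hm₁ μ ((measure_mono hDK₁).trans_lt hK₁.measure_lt_top).ne,
    hD₂.latticeCovolume_eq hm₂ μ ((measure_mono hDK₂).trans_lt hK₂.measure_lt_top).ne]
  exact ⟨f, fun S₁ S₂ hfin₁ hS₁ hfin₂ hS₂ =>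
    ⟨isQuasiIsometry_of_finite (hasFiniteIncrements_of_mem hK₂ hf')
      (hasFiniteIncrements_of_mem hK₁ hg') (finite_range_inv_mul_comp hK₁ hK₂ hf' hg')
      (finite_range_inv_mul_comp hK₂ hK₁ hg' hf') hS₁ hfin₁ hS₂ hfin₂,
    isQuasiToOne_of_isStrictDomain hD₁ hm₁ hD₂ hm₂ hK₁ hK₂ hDK₁ hDK₂ μ hf hS₂ hfin₂⟩⟩

end Lattices

/-! ### Finite-index subgroups as lattices in a discrete group -/

section FiniteIndex

variable {Γ : Type*} [Group Γ]

theorem IsStrictDomain.encard_eq_index {H : Subgroup Γ} [H.FiniteIndex] {D : Set Γ}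
    (hD : IsStrictDomain H D) : D.encard = H.index := by
  -- The inverse is needed because `D` represents cosets `Hd`, while `Γ ⧸ H` consists of cosets
  -- `dH`.
  have hb : Function.Bijective fun d : D => (((d : Γ)⁻¹ : Γ) : Γ ⧸ H) := by
    constructor
    · rintro ⟨d, hd⟩ ⟨e, he⟩ hde
      have hde' : d * e⁻¹ ∈ H := by simpa using QuotientGroup.eq.1 hde
      have := hD.eq (g := d) (γ := 1) (γ' := ⟨d * e⁻¹, hde'⟩) (by simpa using hd)
        (by simpa [mul_assoc] using he)
      have h1 : 1 = d * e⁻¹ := congrArg Subtype.val this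
      exact Subtype.ext (mul_inv_eq_one.1 h1.symm)
    · intro q
      obtain ⟨g, rfl⟩ := QuotientGroup.mk_surjective q
      obtain ⟨γ, hγ⟩ := (hD g⁻¹).exists
      exact ⟨⟨_, hγ⟩, QuotientGroup.eq.2 (by simp [mul_assoc])⟩
  rw [← ENat.card_coe_set_eq, ENat.card_congr (Equiv.ofBijective _ hb), ENat.card_eq_coe_natCard]
  rfl

theorem latticeCovolume_eq_index_mul [TopologicalSpace Γ] [DiscreteTopology Γ]
    [MeasurableSpace Γ] [BorelSpace Γ] (μ : Measure Γ) [μ.IsHaarMeasure] [μ.Regular]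
    {H : Subgroup Γ} [H.FiniteIndex] [Countable H] (hH : IsUniformLattice H) :
    latticeCovolume μ H = H.index * μ {1} := by
  obtain ⟨D, hD, hm, K, hK, hDK⟩ := hH.exists_isStrictDomain
  have hDfin : D.Finite := hK.finite_of_discrete.subset hDK
  rw [hD.latticeCovolume_eq hm μ ((measure_mono hDK).trans_lt hK.measure_lt_top).ne]
  have hc := hD.encard_eq_index
  rw [hDfin.encard_eq_coe_toFinset_card] at hc
  rw [← hDfin.coe_toFinset, ← sum_measure_singleton]
  simp only [Measure.haar_singleton, Finset.sum_const, nsmul_eq_mul]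
  rw [ENat.natCast_inj.1 hc]

theorem isUniformLattice_of_finiteIndex [TopologicalSpace Γ] [DiscreteTopology Γ]
    (H : Subgroup Γ) [H.FiniteIndex] : IsUniformLattice H :=
  ⟨inferInstance, inferInstance⟩

theorem exists_isGroupMeasureScalingQI_of_finiteIndex {H₁ H₂ : Subgroup Γ}
    (h₁ : H₁.FiniteIndex) (h₂ : H₂.FiniteIndex) (fg₁ : Group.FG H₁) (fg₂ : Group.FG H₂) :
    ∃ f : H₁ → H₂, IsGroupMeasureScalingQI ((H₂.index : ℝ) / (H₁.index : ℝ)) f := by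
  let _ : TopologicalSpace Γ := ⊥
  have : DiscreteTopology Γ := ⟨rfl⟩
  let _ : MeasurableSpace Γ := borel Γ
  have : BorelSpace Γ := ⟨rfl⟩
  have : Countable H₁ := countable_of_group_fg
  have : Countable H₂ := countable_of_group_fg
  have l₁ := isUniformLattice_of_finiteIndex H₁
  have l₂ := isUniformLattice_of_finiteIndex H₂
  let μ : Measure Γ := Measure.haar
  have h := exists_isGroupMeasureScalingQI_of_isUniformLattice μ l₁ l₂ fg₁ fg₂
  -- The common mass `μ {1}` is positive and finite, so it cancels in the ratio.
  rw [latticeCovolume_eq_index_mul μ l₁, latticeCovolume_eq_index_mul μ l₂,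
    ENNReal.mul_div_mul_right _ _ ((isOpen_discrete _).measure_pos μ (Set.singleton_nonempty 1)).ne'
      isCompact_singleton.measure_lt_top.ne, ENNReal.toReal_div] at h
  simpa using h

end FiniteIndex

theorem mainTheorem6 :
    (∀ (G : Type*) [Group G] [TopologicalSpace G] [IsTopologicalGroup G] [LocallyCompactSpace G]
        [T2Space G] [MeasurableSpace G] [BorelSpace G]
        (μ : Measure G) [μ.IsHaarMeasure] [μ.Regular]
        (Γ₁ Γ₂ : Subgroup G),
        IsUniformLattice Γ₁ → IsUniformLattice Γ₂ → Group.FG Γ₁ → Group.FG Γ₂ →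
        ∃ f : Γ₁ → Γ₂, IsGroupMeasureScalingQI
          (latticeCovolume μ Γ₂ / latticeCovolume μ Γ₁).toReal f) ∧
    (∀ (Γ : Type*) [Group Γ] (Γ₁ Γ₂ : Subgroup Γ),
        Γ₁.FiniteIndex → Γ₂.FiniteIndex → Group.FG Γ₁ → Group.FG Γ₂ →
        ∃ f : Γ₁ → Γ₂, IsGroupMeasureScalingQI ((Γ₂.index : ℝ) / (Γ₁.index : ℝ)) f) :=
  ⟨fun _ _ _ _ _ _ _ _ μ _ _ _ _ h₁ h₂ fg₁ fg₂ =>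
    exists_isGroupMeasureScalingQI_of_isUniformLattice μ h₁ h₂ fg₁ fg₂,
  fun _ _ _ _ h₁ h₂ fg₁ fg₂ =>
    exists_isGroupMeasureScalingQI_of_finiteIndex h₁ h₂ fg₁ fg₂⟩
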